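/- Let $X$ be a finite set, let $\overline X=\{\bar x : x\in X\}$ be a disjoint copy of $X$, and let $X^{\pm}=X\cup\overline X$, with the convention $\bar{\bar x}=x$. For a word $v=a_1\cdots a_n$ over $X^{\pm}$ write $v^{\mathrm{rev}}=a_n\cdots a_1$ and $v^{-1}=\bar a_n\cdots\bar a_1$. Let $\mathrm{FIM}(X)$ be the free inverse monoid on $X$, that is, the quotient of the free monoid $(X^{\pm})^*$ by the congruence generated by the relations $ww^{-1}w=w$ and $ww^{-1}zz^{-1}=zz^{-1}ww^{-1}$ for all words $w,z\in (X^{\pm})^*$, and let $\#$ be a symbol not in $X^{\pm}$. **Theorem.** For every finite set $X$, the free inverse monoid $\mathrm{FIM}(X)$ has co-context-free word problem with respect to $X^\pm$: the complement in $(X^{\pm}\cup\{\#\})^*$ of the word problem $$\{u\#v^{\mathrm{rev}} : u,v\in (X^{\pm})^*,\ u=v \text{ in } \mathrm{FIM}(X)\}$$ is a context-free language, and so is the complement of its variant $\{u\#v^{-1} : u,v\in (X^{\pm})^*,\ u=v \text{ in } \mathrm{FIM}(X)\}$. Moreover, the co-word problem $$\{u\#v^{-1} : u,v\in (X^{\pm})^*,\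 u\neq v \text{ in } \mathrm{FIM}(X)\}$$ is a context-free language. -/

import Mathlib

/-! Words over the alphabet `X^± = X ∪ X̄` are lists over `X × Bool`, where `(x, true)` stands for
the letter `x` and `(x, false)` for its formal inverse `x̄`. The formal inverse of a word `w`
(reverse the word and invert each letter) is `FreeGroup.invRev w`. -/

/-- Formal inverse of a word, as an operation on the free monoid over `X^±`. -/
def FIM.wordInv {X : Type*} (w : FreeMonoid (X × Bool)) : FreeMonoid (X × Bool) :=
  FreeMonoid.ofList (FreeGroup.invRev (FreeMonoid.toList w))

/-- The Wagner relations, the standard defining relations of the free inverse monoid: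
`w w⁻¹ w = w` and `w w⁻¹ z z⁻¹ = z z⁻¹ w w⁻¹` for all words `w`, `z` over `X^±`. -/
inductive FIM.WagnerRel (X : Type*) : FreeMonoid (X × Bool) → FreeMonoid (X × Bool) → Prop
  | regular (w : FreeMonoid (X × Bool)) : FIM.WagnerRel X (w * FIM.wordInv w * w) w
  | comm (w z : FreeMonoid (X × Bool)) :
      FIM.WagnerRel X (w * FIM.wordInv w * (z * FIM.wordInv z))
        (z * FIM.wordInv z * (w * FIM.wordInv w))

/-- The free inverse monoid on `X`: the quotient of the free monoid over `X^±` by the congruence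
generated by the Wagner relations. -/
abbrev FIM (X : Type*) : Type _ := (conGen (FIM.WagnerRel X)).Quotient

/-- The element of `FIM X` represented by a letter of `X^±`. -/
def FIM.of {X : Type*} (a : X × Bool) : FIM X :=
  (conGen (FIM.WagnerRel X)).mk' (FreeMonoid.of a)

/-- The word `u # v`, over the alphabet `A` extended by a new symbol `#`, which is `none`. -/
def hashWord {A : Type*} (u v : List A) : List (Option A) :=
  u.map some ++ none :: v.map some

/-- The word problem `{u # v^rev : u =_M v}` of a monoid `M` with respect to letters `A`
interpreted in `M` by `φ`. -/
def wordProblem {A M : Type*} [Monoid M] (φ : A → M) : Language (Option A) :=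
  {s | ∃ u v : List A, (u.map φ).prod = (v.map φ).prod ∧ s = hashWord u v.reverse}

/-- The form `{u # v⁻¹ : u =_M v}` of the word problem for a symmetric alphabet `X^±`. -/
def invWordProblem {X M : Type*} [Monoid M] (φ : X × Bool → M) : Language (Option (X × Bool)) :=
  {s | ∃ u v : List (X × Bool),
    (u.map φ).prod = (v.map φ).prod ∧ s = hashWord u (FreeGroup.invRev v)}

/-- The co-word problem `{u # v⁻¹ : u ≠_M v}` for a symmetric alphabet `X^±`. -/
def coWordProblem {X M : Type*} [Monoid M] (φ : X × Bool → M) : Language (Option (X × Bool)) :=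
  {s | ∃ u v : List (X × Bool),
    (u.map φ).prod ≠ (v.map φ).prod ∧ s = hashWord u (FreeGroup.invRev v)}

/-- A language is co-context-free if its complement is context-free. -/
def IsCoContextFree {T : Type*} (L : Language T) : Prop :=
  Language.IsContextFree (Lᶜ)

/-!
Two words are equal in the free inverse monoid if and only if, read as paths from the identity in
the Cayley graph of the free group, they have the same endpoint and visit the same vertices
(Munn's theorem, `FIM.eval_eq_eval_iff`). For sufficiency, every word equals the product of the
idempotents `g g⁻¹` over the vertices `g` it visits, times its reduced form
(`FIM.eval_eq_treeIdem_mul`); these idempotents commute, so only the set of vertices matters.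

Hence, with `w = v⁻¹`, the words `u` and `v` differ if and only if the path `u w` does not close up,
or one of the two paths `u` and `v` visits a vertex that the other misses (`FIM.eval_ne_iff`). When
`u w` is closed, the vertex of `u` before a suffix `s` is missed by `v` exactly when no prefix of
`w` completes `s` to a closed path. So one only has to guess a position in `u` and check that the
rest of `u w`, started there, never returns to its starting point once `w` has begun; choosing the
last visit of `u` to that vertex, it never returns at all (`FIM.unmatched_iff`). The absolute
position of the vertex plays no role, which is what makes the condition context-free. The condition
with `u` and `v` exchanged is its mirror image under reversal of words. Both the case in which `u w`
does not close up and the case of a missed vertex describe `u # w` as a word that a finite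
transducer, by erasing `#` and possibly a prefix, turns into a word of a grammar of walks.

The grammar of walks (`FIM.WalkCons`) cuts a walk at its first return to the identity. It is correct
because the Cayley graph is a tree: a walk from one neighbour of the identity to another passes
through the identity (`FIM.exists_prefix_eq_bar`). Its rules have the form `n → ε` or `n → a m m'`,
and for such grammars the inverse image under a transducer is generated by a product construction
(`isContextFree_transducerRun`). The complements of the word problems add only the words without
exactly one `#`.
-/

/-! ### Context-free languages as least solutions of systems of equations -/

namespace ContextFreeRule

variable {T : Type*} {N : Type*} {N' : Type*}

/-- The language of a symbol when each nonterminal `n` is interpreted as the language `J n`. -/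
def symbolLang (J : N → Language T) : Symbol T N → Language T
  | .terminal a => {[a]}
  | .nonterminal n => J n

/-- The language of a sentential form under an interpretation of the nonterminals. -/
def formLang (J : N → Language T) (o : List (Symbol T N)) : Language T :=
  (o.map (symbolLang J)).prod

/-- Derivability with respect to a set of rules, finite or not, and with nonterminals in any
universe. -/
def SetDerives (R : Set (ContextFreeRule T N)) :
    List (Symbol T N) → List (Symbol T N) → Prop :=
  Relation.ReflTransGen fun u v => ∃ r ∈ R, r.Rewrites u v

/-- The language of terminal words derivable from the nonterminal `n`. -/
def ruleLang (R : Set (ContextFreeRule T N)) (n : N) : Language T :=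
  {w | SetDerives R [.nonterminal n] (w.map .terminal)}

lemma formLang_append (J : N → Language T) (o o' : List (Symbol T N)) :
    formLang J (o ++ o') = formLang J o * formLang J o' := by
  simp [formLang]

lemma SetDerives.append {R : Set (ContextFreeRule T N)} {u u' v v' : List (Symbol T N)}
    (h : SetDerives R u u') (h' : SetDerives R v v') : SetDerives R (u ++ v) (u' ++ v') := by
  have h1 : SetDerives R (u ++ v) (u' ++ v) := by
    induction h with
    | refl => exact .refl
    | tail _ last ih =>
      obtain ⟨r, hr, hw⟩ := last
      exact ih.tail ⟨r, hr, hw.append_right v⟩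
  refine h1.trans ?_
  clear h1
  induction h' with
  | refl => exact .refl
  | tail _ last ih =>
    obtain ⟨r, hr, hw⟩ := last
    exact ih.tail ⟨r, hr, hw.append_left u'⟩

lemma setDerives_of_mem_formLang {R : Set (ContextFreeRule T N)} (o : List (Symbol T N)) :
    ∀ w, w ∈ formLang (ruleLang R) o → SetDerives R o (w.map .terminal) := by
  induction o with
  | nil =>
    intro w hw
    have : w = [] := by simpa [formLang] using hw
    subst this
    exact .refl
  | cons x o ih =>
    intro w hw
    simp only [formLang, List.map_cons, List.prod_cons, Language.mem_mul] at hw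
    obtain ⟨w1, h1, w2, h2, rfl⟩ := hw
    rw [List.map_append]
    refine SetDerives.append (u := [x]) ?_ (ih w2 h2)
    cases x with
    | terminal a =>
      have : w1 = [a] := h1
      subst this
      exact .refl
    | nonterminal n => exact h1

/-- The languages of a set of rules solve the corresponding system of inclusions. -/
lemma formLang_le_ruleLang {R : Set (ContextFreeRule T N)} {r : ContextFreeRule T N}
    (hr : r ∈ R) : formLang (ruleLang R) r.output ≤ ruleLang R r.input := fun w hw =>
  Relation.ReflTransGen.head ⟨r, hr, Rewrites.input_output⟩ (setDerives_of_mem_formLang _ w hw)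

lemma mem_formLang_terminal (J : N → Language T) (w : List T) :
    w ∈ formLang J (w.map .terminal) := by
  induction w with
  | nil => simp [formLang]
  | cons a w ih =>
    simp only [formLang, List.map_cons, List.prod_cons, Language.mem_mul]
    exact ⟨[a], rfl, w, ih, rfl⟩

/-- The languages of a set of rules are the least solution of the system of inclusions. -/
lemma ruleLang_le {R : Set (ContextFreeRule T N)} (J : N → Language T)
    (hJ : ∀ r ∈ R, formLang J r.output ≤ J r.input) (n : N) : ruleLang R n ≤ J n := by
  intro w hw
  have key : ∀ o, SetDerives R o (w.map .terminal) → w ∈ formLang J o := by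
    intro o ho
    induction ho using Relation.ReflTransGen.head_induction_on with
    | refl => exact mem_formLang_terminal J w
    | head h _ ih =>
      obtain ⟨r, hr, hw⟩ := h
      obtain ⟨p, q, rfl, rfl⟩ := hw.exists_parts
      simp only [formLang_append] at ih ⊢
      have h1 : formLang J r.output ≤ formLang J [.nonterminal r.input] := by
        simpa [formLang, symbolLang] using hJ r hr
      have h2 : formLang J p * formLang J r.output * formLang J q ≤
          formLang J p * formLang J [.nonterminal r.input] * formLang J q :=
        mul_le_mul' (mul_le_mul' le_rfl h1) le_rfl
      exact h2 ih
  have h3 : formLang J [.nonterminal n] = J n := by simp [formLang, symbolLang]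
  exact h3 ▸ key _ hw

/-- Renaming of nonterminals in a symbol. -/
def mapSymbol (f : N → N') : Symbol T N → Symbol T N'
  | .terminal a => .terminal a
  | .nonterminal n => .nonterminal (f n)

/-- Renaming of nonterminals in a rule. -/
def mapRule (f : N → N') (r : ContextFreeRule T N) : ContextFreeRule T N' :=
  ⟨f r.input, r.output.map (mapSymbol f)⟩

lemma formLang_map (f : N → N') (J : N' → Language T) (o : List (Symbol T N)) :
    formLang J (o.map (mapSymbol f)) = formLang (fun n => J (f n)) o := by
  unfold formLang
  rw [List.map_map]
  congr 2
  funext x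
  cases x <;> rfl

lemma ruleLang_le_map (f : N → N') {R : Set (ContextFreeRule T N)}
    {R' : Set (ContextFreeRule T N')} (h : ∀ r ∈ R, mapRule f r ∈ R') (n : N) :
    ruleLang R n ≤ ruleLang R' (f n) := by
  refine ruleLang_le (fun n => ruleLang R' (f n)) (fun r hr => ?_) n
  rw [← formLang_map f]
  exact formLang_le_ruleLang (h r hr)

lemma isContextFree_ruleLang {N : Type} {R : Set (ContextFreeRule T N)} (hR : R.Finite) (n : N) :
    (ruleLang R n).IsContextFree := by
  refine ⟨⟨N, n, hR.toFinset⟩, ?_⟩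
  ext w
  simp only [ContextFreeGrammar.mem_language_iff, ContextFreeGrammar.Derives]
  have : (ContextFreeGrammar.mk N n hR.toFinset).Produces =
      fun u v => ∃ r ∈ R, r.Rewrites u v := by
    funext u v
    simp [ContextFreeGrammar.Produces]
  rw [this]
  rfl

instance [Finite T] [Finite N] : Finite (Symbol T N) :=
  Finite.of_surjective (Sum.elim Symbol.terminal Symbol.nonterminal) fun s => by
    cases s with
    | terminal a => exact ⟨.inl a, rfl⟩
    | nonterminal n => exact ⟨.inr n, rfl⟩

lemma finite_of_length_le [Finite T] [Finite N] {R : Set (ContextFreeRule T N)} (k : ℕ)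
    (h : ∀ r ∈ R, r.output.length ≤ k) : R.Finite := by
  have hf : (Set.univ ×ˢ {l : List (Symbol T N) | l.length ≤ k} :
      Set (N × List (Symbol T N))).Finite := Set.finite_univ.prod (List.finite_length_le _ k)
  refine (hf.image fun p => ContextFreeRule.mk p.1 p.2).subset fun r hr => ?_
  exact ⟨(r.input, r.output), ⟨trivial, h r hr⟩, rfl⟩

lemma isContextFree_ruleLang_of_length_le [Finite T] [Finite N] {R : Set (ContextFreeRule T N)}
    (k : ℕ) (h : ∀ r ∈ R, r.output.length ≤ k) (n : N) : (ruleLang R n).IsContextFree := by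
  obtain ⟨m, ⟨e⟩⟩ := Finite.exists_equiv_fin N
  have hR := finite_of_length_le k h
  have h1 : ruleLang R n = ruleLang (mapRule e '' R) (e n) := by
    refine le_antisymm (ruleLang_le_map e (fun r hr => Set.mem_image_of_mem _ hr) n) ?_
    have := ruleLang_le_map (R := mapRule e '' R) (R' := R) e.symm ?_ (e n)
    · simpa using this
    · rintro _ ⟨r, hr, rfl⟩
      have hid : mapSymbol (T := T) e.symm ∘ mapSymbol e = id := by
        funext x
        cases x <;> simp [mapSymbol]
      have : mapRule e.symm (mapRule e r) = r := by
        simp [mapRule, hid]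
      rwa [this]
  rw [h1]
  exact isContextFree_ruleLang (hR.image _) _

end ContextFreeRule

open ContextFreeRule in
/-- Context-free languages are closed under union. -/
lemma Language.IsContextFree.sup {T : Type*} {L L' : Language T} (h : L.IsContextFree)
    (h' : L'.IsContextFree) : (L ⊔ L').IsContextFree := by
  obtain ⟨g, rfl⟩ := h
  obtain ⟨g', rfl⟩ := h'
  let i : g.NT → Option (g.NT ⊕ g'.NT) := fun n => some (.inl n)
  let i' : g'.NT → Option (g.NT ⊕ g'.NT) := fun n => some (.inr n)
  let R : Set (ContextFreeRule T (Option (g.NT ⊕ g'.NT))) :=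
    insert ⟨none, [.nonterminal (i g.initial)]⟩ (insert ⟨none, [.nonterminal (i' g'.initial)]⟩
      (mapRule i '' g.rules ∪ mapRule i' '' g'.rules))
  have hR : R.Finite := ((((Finset.finite_toSet _).image _).union
    ((Finset.finite_toSet _).image _)).insert _).insert _
  have hg : g.language = ruleLang (g.rules : Set _) g.initial := rfl
  have hg' : g'.language = ruleLang (g'.rules : Set _) g'.initial := rfl
  suffices g.language ⊔ g'.language = ruleLang R none by
    rw [this]
    exact isContextFree_ruleLang hR _
  rw [hg, hg']
  have hi : ∀ r ∈ (g.rules : Set _), mapRule i r ∈ R := fun r hr =>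
    Set.mem_insert_of_mem _ (Set.mem_insert_of_mem _ (Or.inl ⟨r, hr, rfl⟩))
  have hi' : ∀ r ∈ (g'.rules : Set _), mapRule i' r ∈ R := fun r hr =>
    Set.mem_insert_of_mem _ (Set.mem_insert_of_mem _ (Or.inr ⟨r, hr, rfl⟩))
  apply le_antisymm
  · refine sup_le ?_ ?_
    · refine (ruleLang_le_map i hi _).trans ?_
      have := formLang_le_ruleLang (R := R) (Set.mem_insert _ _)
      simpa [formLang, symbolLang] using this
    · refine (ruleLang_le_map i' hi' _).trans ?_
      have := formLang_le_ruleLang (R := R) (Set.mem_insert_of_mem _ (Set.mem_insert _ _))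
      simpa [formLang, symbolLang] using this
  · let J : Option (g.NT ⊕ g'.NT) → Language T
      | none => ruleLang (g.rules : Set _) g.initial ⊔ ruleLang (g'.rules : Set _) g'.initial
      | some (.inl n) => ruleLang (g.rules : Set _) n
      | some (.inr n) => ruleLang (g'.rules : Set _) n
    refine ruleLang_le J ?_ none
    rintro r (rfl | rfl | ⟨r, hr, rfl⟩ | ⟨r, hr, rfl⟩)
    · simp [formLang, symbolLang, J, i]
    · simp [formLang, symbolLang, J, i']
    · exact (formLang_map i J r.output).trans_le (formLang_le_ruleLang hr)
    · exact (formLang_map i' J r.output).trans_le (formLang_le_ruleLang hr)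

lemma Language.IsContextFree.congr {T : Type*} {L L' : Language T} (h : L.IsContextFree)
    (e : ∀ z, z ∈ L' ↔ z ∈ L) : L'.IsContextFree := by
  obtain rfl : L' = L := Set.ext e
  exact h

/-! ### Transductions of grammars in Greibach-like form -/

/-- Words generated by a grammar all of whose rules have the form `n → ε` (for `E n`) or
`n → a m m'` (for `B n a m m'`). -/
inductive GreibachGen {A N : Type*} (E : N → Prop) (B : N → A → N → N → Prop) : N → List A → Prop
  | nil {n : N} : E n → GreibachGen E B n []
  | cons {n m m' : N} {a : A} {x y : List A} : B n a m m' → GreibachGen E B m x →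
      GreibachGen E B m' y → GreibachGen E B n (a :: (x ++ y))

/-- Runs of a nondeterministic transducer whose steps read one letter and write at most one:
`TransducerRun step s z t y` says that reading `z` it may go from `s` to `t` and write `y`. -/
inductive TransducerRun {T A Q : Type*} (step : Q → T → Option A → Q → Prop) :
    Q → List T → Q → List A → Prop
  | nil (s : Q) : TransducerRun step s [] s []
  | skip {s r t : Q} {x : T} {z : List T} {y : List A} : step s x none r →
      TransducerRun step r z t y → TransducerRun step s (x :: z) t y
  | emit {s r t : Q} {x : T} {a : A} {z : List T} {y : List A} : step s x (some a) r →
      TransducerRun step r z t y → TransducerRun step s (x :: z) t (a :: y)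

namespace TransducerRun

variable {T A Q : Type*} {step : Q → T → Option A → Q → Prop}

lemma append {s r t : Q} {z z' : List T} {y y' : List A} (h : TransducerRun step s z r y)
    (h' : TransducerRun step r z' t y') : TransducerRun step s (z ++ z') t (y ++ y') := by
  induction h with
  | nil => exact h'
  | skip hs _ ih => exact .skip hs (ih h')
  | emit hs _ ih => exact .emit hs (ih h')

lemma exists_of_append {s t : Q} {z : List T} {y : List A} (h : TransducerRun step s z t y) :
    ∀ y1 y2, y = y1 ++ y2 → ∃ z1 r z2, z = z1 ++ z2 ∧ TransducerRun step s z1 r y1 ∧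
      TransducerRun step r z2 t y2 := by
  induction h with
  | nil s =>
    intro y1 y2 h
    obtain ⟨rfl, rfl⟩ := List.append_eq_nil_iff.1 h.symm
    exact ⟨[], s, [], rfl, .nil s, .nil s⟩
  | skip hs _ ih =>
    intro y1 y2 h
    obtain ⟨z1, r, z2, rfl, h1, h2⟩ := ih y1 y2 h
    exact ⟨_ :: z1, r, z2, rfl, .skip hs h1, h2⟩
  | @emit s r t x a z y hs hrun ih =>
    intro y1 y2 h
    cases y1 with
    | nil =>
      refine ⟨[], s, _, rfl, .nil s, ?_⟩
      rw [List.nil_append] at h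
      rw [← h]
      exact .emit hs hrun
    | cons b y1 =>
      obtain ⟨rfl, rfl⟩ := List.cons_eq_cons.1 h
      obtain ⟨z1, r, z2, rfl, h1, h2⟩ := ih y1 y2 rfl
      exact ⟨_ :: z1, r, z2, rfl, .emit hs h1, h2⟩

end TransducerRun

/-- The product of a grammar with a transducer. The nonterminal `(n, s, t)` stands for the inputs
of runs from `s` to `t` that write a word generated by `n`. -/
inductive TransducedRule {T A N Q : Type*} (E : N → Prop) (B : N → A → N → N → Prop)
    (step : Q → T → Option A → Q → Prop) : ContextFreeRule T (N × Q × Q) → Prop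
  | nil (n : N) (s : Q) : E n → TransducedRule E B step ⟨(n, s, s), []⟩
  | skip (n : N) (s r t : Q) (x : T) : step s x none r →
      TransducedRule E B step ⟨(n, s, t), [.terminal x, .nonterminal (n, r, t)]⟩
  | emit (n m m' : N) (a : A) (s r r' t : Q) (x : T) : step s x (some a) r → B n a m m' →
      TransducedRule E B step
        ⟨(n, s, t), [.terminal x, .nonterminal (m, r, r'), .nonterminal (m', r', t)]⟩

open ContextFreeRule in
/-- The inverse image, under a finite transducer, of the language of a Greibach-like grammar is
context-free. -/
theorem isContextFree_transducerRun {T A N Q : Type*} [Finite T] [Finite N] [Finite Q]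
    (E : N → Prop) (B : N → A → N → N → Prop) (step : Q → T → Option A → Q → Prop)
    (n : N) (s t : Q) :
    Language.IsContextFree
      ({z | ∃ y, GreibachGen E B n y ∧ TransducerRun step s z t y} : Language T) := by
  let R : Set (ContextFreeRule T (N × Q × Q)) := {r | TransducedRule E B step r}
  let J : N × Q × Q → Language T := fun p =>
    {z | ∃ y, GreibachGen E B p.1 y ∧ TransducerRun step p.2.1 z p.2.2 y}
  suffices J (n, s, t) = ruleLang R (n, s, t) by
    change (J (n, s, t)).IsContextFree
    rw [this]
    refine isContextFree_ruleLang_of_length_le 3 ?_ _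
    rintro r (_ | _ | _) <;> simp
  apply le_antisymm
  · rintro z ⟨y, hy, hz⟩
    change GreibachGen E B n y at hy
    change TransducerRun step s z t y at hz
    have hskip : ∀ n s r t x z, step s x none r → z ∈ ruleLang R (n, r, t) →
        x :: z ∈ ruleLang R (n, s, t) := by
      intro n s r t x z hs hz
      refine formLang_le_ruleLang (R := R) (TransducedRule.skip n s r t x hs) ?_
      simp only [formLang, List.map_cons, List.prod_cons, symbolLang]
      exact ⟨[x], rfl, z, ⟨z, hz, [], rfl, by simp⟩, rfl⟩
    induction hy generalizing s z t with
    | nil hE =>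
      generalize hy : ([] : List A) = y at hz
      induction hz with
      | nil s =>
        refine formLang_le_ruleLang (R := R) (TransducedRule.nil _ s hE) ?_
        exact (Language.mem_one _).2 rfl
      | skip hs _ ih => exact hskip _ _ _ _ _ _ hs (ih hy)
      | emit => cases hy
    | @cons n m m' a u v hB hu hv ihu ihv =>
      generalize hy : a :: (u ++ v) = y at hz
      induction hz with
      | nil s => cases hy
      | skip hs _ ih => exact hskip _ _ _ _ _ _ hs (ih hy)
      | @emit s r t x b z y hs hrun _ =>
        obtain ⟨rfl, rfl⟩ := List.cons_eq_cons.1 hy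
        obtain ⟨z1, r', z2, rfl, h1, h2⟩ := hrun.exists_of_append u v rfl
        refine formLang_le_ruleLang (R := R) (TransducedRule.emit n m m' a s r r' t x hs hB) ?_
        simp only [formLang, List.map_cons, List.prod_cons, symbolLang]
        exact ⟨[x], rfl, _, ⟨z1, ihu _ _ h1, z2, ⟨z2, ihv _ _ h2, [], rfl, by simp⟩, rfl⟩, rfl⟩
  · refine ruleLang_le J ?_ _
    rintro r (⟨n, s, hE⟩ | ⟨n, s, r, t, x, hs⟩ | ⟨n, m, m', a, s, r, r', t, x, hs, hB⟩)
    · intro z hz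
      have : z = [] := (Language.mem_one _).1 hz
      subst this
      exact ⟨[], .nil hE, .nil s⟩
    · intro z hz
      simp only [formLang, List.map_cons, List.map_nil, List.prod_cons, List.prod_nil, mul_one,
        symbolLang] at hz
      obtain ⟨_, rfl, z, ⟨y, hy, hzy⟩, rfl⟩ := Language.mem_mul.1 hz
      exact ⟨y, hy, .skip hs hzy⟩
    · intro z hz
      simp only [formLang, List.map_cons, List.map_nil, List.prod_cons, List.prod_nil, mul_one,
        symbolLang] at hz
      obtain ⟨_, rfl, z', hz', rfl⟩ := Language.mem_mul.1 hz
      obtain ⟨z1, ⟨y1, hy1, h1⟩, z2, ⟨y2, hy2, h2⟩, rfl⟩ := Language.mem_mul.1 hz'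
      exact ⟨a :: (y1 ++ y2), .cons hB hy1 hy2, .emit hs (h1.append h2)⟩

/-! ### Munn's theorem -/

namespace FIM

variable {X : Type*}

/-- The formal inverse of a letter. -/
def bar (a : X × Bool) : X × Bool := (a.1, !a.2)

@[simp] lemma bar_bar (a : X × Bool) : bar (bar a) = a := by simp [bar]

lemma invRev_singleton (a : X × Bool) : FreeGroup.invRev [a] = [bar a] := rfl

lemma invRev_eq (w : List (X × Bool)) : FreeGroup.invRev w = (w.map bar).reverse := rfl

lemma mk_bar (a : X × Bool) : FreeGroup.mk [bar a] = (FreeGroup.mk [a])⁻¹ := by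
  rw [FreeGroup.inv_mk, invRev_singleton]

open Classical in
/-- Multiplying by a letter on the right either appends that letter to the reduced word or
deletes its last letter: the Cayley graph of a free group is a tree. -/
lemma toWord_mul_letter (g : FreeGroup X) (c : X × Bool) :
    (g * FreeGroup.mk [c]).toWord = g.toWord ++ [c] ∨
      g.toWord = (g * FreeGroup.mk [c]).toWord ++ [bar c] := by
  have key : ∀ (h : FreeGroup X) (a : X × Bool),
      (FreeGroup.mk [a] * h).toWord = a :: h.toWord ∨
        h.toWord = bar a :: (FreeGroup.mk [a] * h).toWord := by
    intro h a
    have h1 : (FreeGroup.mk [a] * h).toWord = FreeGroup.reduce (a :: h.toWord) := by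
      conv_lhs => rw [← FreeGroup.mk_toWord (x := h)]
      rw [FreeGroup.mul_mk, FreeGroup.toWord_mk]
      rfl
    rw [h1, FreeGroup.reduce.cons, FreeGroup.reduce_toWord]
    cases h.toWord with
    | nil => simp
    | cons b l =>
      by_cases hab : a.1 = b.1 ∧ a.2 = !b.2
      · right
        have : b = bar a := by
          ext <;> simp [bar, hab]
        subst this
        simp [bar]
      · left
        simp [hab]
  have h2 := key g⁻¹ (bar c)
  have h3 : FreeGroup.mk [bar c] * g⁻¹ = (g * FreeGroup.mk [c])⁻¹ := by
    rw [mk_bar, mul_inv_rev]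
  rw [h3, bar_bar, FreeGroup.toWord_inv, FreeGroup.toWord_inv] at h2
  refine h2.imp (fun h => ?_) fun h => ?_
  · apply FreeGroup.invRev_injective
    rw [h, FreeGroup.invRev_append]
    rfl
  · apply FreeGroup.invRev_injective
    rw [h, FreeGroup.invRev_append]
    simp [FreeGroup.invRev, bar]

/-- The element of the free inverse monoid represented by a word. -/
def eval (w : List (X × Bool)) : FIM X := (conGen (WagnerRel X)).mk' (FreeMonoid.ofList w)

lemma eval_append (u v : List (X × Bool)) : eval (u ++ v) = eval u * eval v := by
  simp [eval, FreeMonoid.ofList_append]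

lemma eval_nil : eval ([] : List (X × Bool)) = 1 := by simp [eval]

lemma prod_map_of (w : List (X × Bool)) : (w.map of).prod = eval w := by
  induction w with
  | nil => simp [eval_nil]
  | cons a w ih =>
    rw [List.map_cons, List.prod_cons, ih, ← List.singleton_append, eval_append]
    rfl

/-- The idempotent `w w⁻¹` of the free inverse monoid. -/
def idem (w : List (X × Bool)) : FIM X := eval w * eval (FreeGroup.invRev w)

lemma idem_mul_eval (w : List (X × Bool)) : idem w * eval w = eval w := by
  have := (conGen (WagnerRel X)).eq.2
    (Con.le_conGen _ _ (WagnerRel.regular (FreeMonoid.ofList w)))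
  exact this

lemma idem_mul_comm (w z : List (X × Bool)) : idem w * idem z = idem z * idem w := by
  have := (conGen (WagnerRel X)).eq.2
    (Con.le_conGen _ _ (WagnerRel.comm (FreeMonoid.ofList w) (FreeMonoid.ofList z)))
  exact this

lemma idem_mul_self (w : List (X × Bool)) : idem w * idem w = idem w := by
  change idem w * (eval w * _) = _
  rw [← mul_assoc, idem_mul_eval]
  rfl

section Munn

open Classical

/-- The idempotent attached to a vertex of the Cayley graph. -/
noncomputable def vertexIdem (g : FreeGroup X) : FIM X := idem g.toWord

/-- The product of the idempotents attached to a list of vertices. -/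
noncomputable def treeIdem (l : List (FreeGroup X)) : FIM X := (l.map vertexIdem).prod

lemma treeIdem_cons (g : FreeGroup X) (l : List (FreeGroup X)) :
    treeIdem (g :: l) = vertexIdem g * treeIdem l := by
  simp [treeIdem]

lemma commute_vertexIdem_treeIdem (g : FreeGroup X) (l : List (FreeGroup X)) :
    Commute (vertexIdem g) (treeIdem l) := by
  induction l with
  | nil => exact Commute.one_right _
  | cons h l ih =>
    rw [treeIdem_cons]
    exact Commute.mul_right (idem_mul_comm _ _) ih

lemma vertexIdem_mul_treeIdem {g : FreeGroup X} {l : List (FreeGroup X)} (hg : g ∈ l) :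
    vertexIdem g * treeIdem l = treeIdem l := by
  induction l with
  | nil => cases hg
  | cons h l ih =>
    rw [treeIdem_cons]
    rcases List.mem_cons.1 hg with rfl | hg
    · rw [← mul_assoc]
      exact congrArg (· * _) (idem_mul_self _)
    · rw [← mul_assoc, show vertexIdem g * vertexIdem h = vertexIdem h * vertexIdem g from
        idem_mul_comm _ _, mul_assoc, ih hg]

lemma treeIdem_mul_treeIdem {l l' : List (FreeGroup X)} (h : ∀ g ∈ l, g ∈ l') :
    treeIdem l * treeIdem l' = treeIdem l' := by
  induction l with
  | nil => simp [treeIdem]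
  | cons g l ih =>
    rw [treeIdem_cons, mul_assoc, ih fun x hx => h x (List.mem_cons_of_mem _ hx),
      vertexIdem_mul_treeIdem (h g List.mem_cons_self)]

lemma commute_treeIdem (l l' : List (FreeGroup X)) : Commute (treeIdem l) (treeIdem l') := by
  induction l with
  | nil => exact Commute.one_left _
  | cons g l ih =>
    rw [treeIdem_cons]
    exact Commute.mul_left (commute_vertexIdem_treeIdem g l') ih

lemma treeIdem_congr {l l' : List (FreeGroup X)} (h : ∀ g, g ∈ l ↔ g ∈ l') :
    treeIdem l = treeIdem l' := by
  rw [← treeIdem_mul_treeIdem fun g hg => (h g).2 hg, ← (commute_treeIdem l l').eq,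
    treeIdem_mul_treeIdem fun g hg => (h g).1 hg]

/-- Munn's canonical form: a word is the product of the idempotents attached to the vertices it
visits, times its reduced form. -/
lemma eval_eq_treeIdem_mul (u : List (X × Bool)) :
    eval u = treeIdem (u.inits.map FreeGroup.mk) * eval (FreeGroup.mk u).toWord := by
  induction u using List.reverseRecOn with
  | nil =>
    simp [treeIdem, vertexIdem, idem, ← FreeGroup.one_eq_mk, FreeGroup.toWord_one, eval_nil]
  | append_singleton u c ih =>
    set l := u.inits.map FreeGroup.mk with hl
    set g : FreeGroup X := FreeGroup.mk u with hg
    have hmem : g ∈ l := List.mem_map.2 ⟨u, by simp, rfl⟩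
    have hgc : FreeGroup.mk (u ++ [c]) = g * FreeGroup.mk [c] := (FreeGroup.mul_mk).symm
    have hinits : (u ++ [c]).inits.map FreeGroup.mk = l ++ [g * FreeGroup.mk [c]] := by
      simp [List.inits_append, hl, hgc]
    have htree : treeIdem (l ++ [g * FreeGroup.mk [c]]) =
        treeIdem l * vertexIdem (g * FreeGroup.mk [c]) := by simp [treeIdem]
    rw [hinits, htree, hgc, eval_append, ih, mul_assoc, mul_assoc]
    set h := g * FreeGroup.mk [c]
    have hh : vertexIdem h * eval h.toWord = eval h.toWord := idem_mul_eval _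
    rw [hh]
    have hw : h.toWord = g.toWord ++ [c] ∨ g.toWord = h.toWord ++ [bar c] :=
      toWord_mul_letter g c
    rcases hw with hw | hw
    · rw [hw, eval_append]
    · -- The letter `c` cancels; `g` is a vertex already visited, so its idempotent, which absorbs
      -- the detour `c⁻¹ c`, is available in the tree.
      have h1 : eval g.toWord * eval [c] = vertexIdem g * eval h.toWord := by
        have hcomm := idem_mul_comm [bar c] (FreeGroup.invRev h.toWord)
        have hreg := idem_mul_eval h.toWord
        simp only [idem, invRev_singleton, bar_bar, FreeGroup.invRev_invRev] at hcomm hreg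
        rw [vertexIdem, idem, hw, FreeGroup.invRev_append, invRev_singleton, bar_bar,
          eval_append, eval_append]
        calc eval h.toWord * eval [bar c] * eval [c]
            = eval h.toWord * eval (FreeGroup.invRev h.toWord) * eval h.toWord *
                eval [bar c] * eval [c] := by rw [hreg]
          _ = eval h.toWord * (eval (FreeGroup.invRev h.toWord) * eval h.toWord *
                (eval [bar c] * eval [c])) := by simp only [mul_assoc]
          _ = _ := by rw [← hcomm]; simp only [mul_assoc]
      rw [h1, ← mul_assoc, ← (commute_vertexIdem_treeIdem g l).eq, vertexIdem_mul_treeIdem hmem]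

end Munn

/-- The Munn tree of a word: the vertices of the Cayley graph of the free group visited by the
path that starts at the identity and is labelled by the word. -/
def munnTree (u : List (X × Bool)) : Set (FreeGroup X) := {g | ∃ p, p <+: u ∧ FreeGroup.mk p = g}

lemma prefix_append_cases {T : Type*} {p u v : List T} (h : p <+: u ++ v) :
    p <+: u ∨ ∃ q, p = u ++ q ∧ q <+: v := by
  obtain ⟨t, ht⟩ := h
  rcases List.append_eq_append_iff.1 ht with ⟨q, rfl, -⟩ | ⟨q, rfl, rfl⟩
  · exact .inl (List.prefix_append _ _)
  · exact .inr ⟨q, rfl, List.prefix_append _ _⟩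

lemma mem_munnTree_append (u v : List (X × Bool)) (g : FreeGroup X) :
    g ∈ munnTree (u ++ v) ↔ g ∈ munnTree u ∨ (FreeGroup.mk u)⁻¹ * g ∈ munnTree v := by
  constructor
  · rintro ⟨p, hp, rfl⟩
    rcases prefix_append_cases hp with h | ⟨q, rfl, hq⟩
    · exact .inl ⟨p, h, rfl⟩
    · exact .inr ⟨q, hq, by rw [← FreeGroup.mul_mk, inv_mul_cancel_left]⟩
  · rintro (⟨p, hp, rfl⟩ | ⟨q, hq, h⟩)
    · exact ⟨p, hp.trans (List.prefix_append _ _), rfl⟩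
    · refine ⟨u ++ q, (List.prefix_append_right_inj u).2 hq, ?_⟩
      rw [← FreeGroup.mul_mk, h, mul_inv_cancel_left]

lemma munnTree_invRev (w : List (X × Bool)) (g : FreeGroup X) :
    g ∈ munnTree (FreeGroup.invRev w) ↔ FreeGroup.mk w * g ∈ munnTree w := by
  have key : ∀ (w : List (X × Bool)) (g), FreeGroup.mk w * g ∈ munnTree w →
      g ∈ munnTree (FreeGroup.invRev w) := by
    rintro w g ⟨p, ⟨q, rfl⟩, h⟩
    refine ⟨FreeGroup.invRev q, ?_, ?_⟩
    · rw [FreeGroup.invRev_append]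
      exact List.prefix_append _ _
    · rw [← FreeGroup.inv_mk, inv_eq_iff_mul_eq_one]
      rw [← FreeGroup.mul_mk, mul_assoc] at h
      simpa using h.symm
  refine ⟨fun h => ?_, key w g⟩
  have := key (FreeGroup.invRev w) (FreeGroup.mk w * g)
  rw [FreeGroup.invRev_invRev, ← FreeGroup.inv_mk, inv_mul_cancel_left] at this
  exact this h

/-- The congruence identifying words with the same Munn tree and the same endpoint. -/
def munnCon (X : Type*) : Con (FreeMonoid (X × Bool)) where
  r u v := FreeGroup.mk u.toList = FreeGroup.mk v.toList ∧ munnTree u.toList = munnTree v.toList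
  iseqv := ⟨fun _ => ⟨rfl, rfl⟩, fun h => ⟨h.1.symm, h.2.symm⟩,
    fun h h' => ⟨h.1.trans h'.1, h.2.trans h'.2⟩⟩
  mul' {u u' v v'} h h' := by
    refine ⟨?_, ?_⟩
    · rw [FreeMonoid.toList_mul, FreeMonoid.toList_mul, ← FreeGroup.mul_mk, ← FreeGroup.mul_mk,
        h.1, h'.1]
    · ext g
      rw [FreeMonoid.toList_mul, FreeMonoid.toList_mul, mem_munnTree_append, mem_munnTree_append,
        h.1, h.2, h'.2]

lemma mem_munnTree_idem (w : List (X × Bool)) (g : FreeGroup X) :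
    g ∈ munnTree (w ++ FreeGroup.invRev w) ↔ g ∈ munnTree w := by
  rw [mem_munnTree_append, munnTree_invRev, mul_inv_cancel_left, or_self]

lemma mk_append_invRev (w : List (X × Bool)) : FreeGroup.mk (w ++ FreeGroup.invRev w) = 1 := by
  rw [← FreeGroup.mul_mk, ← FreeGroup.inv_mk, mul_inv_cancel]

lemma wagnerRel_le_munnCon {u v : FreeMonoid (X × Bool)} (h : WagnerRel X u v) :
    munnCon X u v := by
  cases h with
  | regular w =>
    refine ⟨?_, Set.ext fun g => ?_⟩
    · change FreeGroup.mk ((v.toList ++ FreeGroup.invRev v.toList) ++ v.toList) = _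
      rw [← FreeGroup.mul_mk, mk_append_invRev, one_mul]
    · change g ∈ munnTree ((v.toList ++ FreeGroup.invRev v.toList) ++ v.toList) ↔ _
      rw [mem_munnTree_append, mk_append_invRev, mem_munnTree_idem, inv_one, one_mul, or_self]
  | comm w z =>
    change FreeGroup.mk ((w.toList ++ FreeGroup.invRev w.toList) ++
      (z.toList ++ FreeGroup.invRev z.toList)) = FreeGroup.mk
      ((z.toList ++ FreeGroup.invRev z.toList) ++ (w.toList ++ FreeGroup.invRev w.toList)) ∧
      munnTree ((w.toList ++ FreeGroup.invRev w.toList) ++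
      (z.toList ++ FreeGroup.invRev z.toList)) = munnTree
      ((z.toList ++ FreeGroup.invRev z.toList) ++ (w.toList ++ FreeGroup.invRev w.toList))
    refine ⟨?_, Set.ext fun g => ?_⟩
    · rw [← FreeGroup.mul_mk (L₁ := w.toList ++ _), ← FreeGroup.mul_mk (L₁ := z.toList ++ _),
        mk_append_invRev, mk_append_invRev]
    · rw [mem_munnTree_append (w.toList ++ _), mem_munnTree_append (z.toList ++ _),
        mk_append_invRev, mk_append_invRev, inv_one, one_mul, or_comm]

/-- Munn's theorem: two words are equal in the free inverse monoid if and only if they have the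
same endpoint and the same Munn tree. -/
theorem eval_eq_eval_iff (u v : List (X × Bool)) :
    eval u = eval v ↔ FreeGroup.mk u = FreeGroup.mk v ∧ munnTree u = munnTree v := by
  constructor
  · intro h
    have h1 : conGen (WagnerRel X) (FreeMonoid.ofList u) (FreeMonoid.ofList v) := (Con.eq _).1 h
    exact Con.conGen_le.2 (fun _ _ => wagnerRel_le_munnCon) h1
  · rintro ⟨h, ht⟩
    rw [eval_eq_treeIdem_mul, eval_eq_treeIdem_mul v, h]
    congr 1
    refine treeIdem_congr fun g => ?_
    have := Set.ext_iff.1 ht g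
    simpa [munnTree] using this

end FIM

/-! ### Walks in the Cayley graph of a free group -/

namespace FIM

variable {X : Type*}

section Tree

open Classical

lemma toWord_mk_singleton (a : X × Bool) : (FreeGroup.mk [a]).toWord = [a] := by
  rw [FreeGroup.toWord_mk, FreeGroup.reduce_singleton]

lemma mk_singleton_ne_one (a : X × Bool) : (1 : FreeGroup X) ≠ FreeGroup.mk [a] := by
  intro h
  have := congrArg FreeGroup.toWord h
  rw [toWord_mk_singleton, FreeGroup.toWord_one] at this
  cases this

lemma mk_cons (a : X × Bool) (w : List (X × Bool)) :
    FreeGroup.mk (a :: w) = FreeGroup.mk [a] * FreeGroup.mk w := by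
  rw [FreeGroup.mul_mk, List.singleton_append]

lemma mk_cons_eq_one_iff (a : X × Bool) (w : List (X × Bool)) :
    FreeGroup.mk (a :: w) = 1 ↔ FreeGroup.mk w = FreeGroup.mk [bar a] := by
  rw [mk_cons, mk_bar, mul_eq_one_iff_eq_inv', eq_comm]

/-- A walk leaving the set of reduced words that start with `c` passes through the identity. -/
lemma exists_prefix_mul_eq_one (c : X × Bool) (z : List (X × Bool)) :
    ∀ g : FreeGroup X, (∃ l, g.toWord = c :: l) → (¬∃ l, (g * FreeGroup.mk z).toWord = c :: l) →
      ∃ p, p <+: z ∧ g * FreeGroup.mk p = 1 := by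
  induction z with
  | nil =>
    intro g hg hz
    rw [← FreeGroup.one_eq_mk, mul_one] at hz
    exact absurd hg hz
  | cons d z ih =>
    intro g hg hz
    by_cases hgd : ∃ l, (g * FreeGroup.mk [d]).toWord = c :: l
    · rw [mk_cons, ← mul_assoc] at hz
      obtain ⟨p, hp, h⟩ := ih _ hgd hz
      refine ⟨d :: p, List.prefix_cons_inj d |>.2 hp, ?_⟩
      rw [mk_cons, ← mul_assoc, h]
    · refine ⟨[d], by simp, ?_⟩
      obtain ⟨l, hl⟩ := hg
      rcases toWord_mul_letter g d with h | h
      · exact absurd ⟨l ++ [d], by rw [h, hl]; rfl⟩ hgd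
      · rw [← FreeGroup.toWord_eq_nil_iff]
        rcases hw : (g * FreeGroup.mk [d]).toWord with _ | ⟨e, l'⟩
        · rfl
        · rw [hl, hw] at h
          obtain ⟨rfl, -⟩ := List.cons_eq_cons.1 h
          exact absurd ⟨l', hw⟩ hgd

/-- A walk from one neighbour of the identity to another passes through the identity. -/
lemma exists_prefix_eq_bar {b c : X × Bool} (hcb : c ≠ b) {z : List (X × Bool)}
    (hz : FreeGroup.mk (c :: z) = FreeGroup.mk [b]) :
    ∃ p, p <+: z ∧ FreeGroup.mk p = FreeGroup.mk [bar c] := by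
  obtain ⟨p, hp, h⟩ := exists_prefix_mul_eq_one c z (FreeGroup.mk [c])
    ⟨[], toWord_mk_singleton c⟩ (by
      rw [← mk_cons, hz, toWord_mk_singleton]
      rintro ⟨l, hl⟩
      exact hcb (List.cons_eq_cons.1 hl).1.symm)
  exact ⟨p, hp, (mk_cons_eq_one_iff c p).1 (by rw [mk_cons, h])⟩

end Tree

/-- The walk `z` from the identity never visits the vertex `b`. -/
def Avoids (b : X × Bool) (z : List (X × Bool)) : Prop :=
  ∀ p, p <+: z → FreeGroup.mk p ≠ FreeGroup.mk [b]

/-- The walk `z` from the identity visits the vertex `b` at its end and not before. -/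
def FirstHits (b : X × Bool) (z : List (X × Bool)) : Prop :=
  FreeGroup.mk z = FreeGroup.mk [b] ∧ ∀ p, p <+: z → FreeGroup.mk p = FreeGroup.mk [b] → p = z

lemma exists_firstHits {b : X × Bool} {z : List (X × Bool)} (h : ¬Avoids b z) :
    ∃ x y, z = x ++ y ∧ FirstHits b x := by
  unfold Avoids at h
  push Not at h
  obtain ⟨p, hp, hb⟩ := h
  induction hn : p.length using Nat.strong_induction_on generalizing p with
  | _ n ih =>
    by_cases hq : ∃ q, q <+: p ∧ FreeGroup.mk q = FreeGroup.mk [b] ∧ q ≠ p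
    · obtain ⟨q, hqp, hqb, hne⟩ := hq
      have hlt : q.length < p.length :=
        lt_of_le_of_ne hqp.length_le fun h => hne (hqp.eq_of_length h)
      exact ih _ (hn ▸ hlt) q (hqp.trans hp) hqb rfl
    · push Not at hq
      obtain ⟨y, rfl⟩ := hp
      exact ⟨p, y, rfl, hb, hq⟩

lemma mk_cons_append_of_firstHits {c : X × Bool} {x : List (X × Bool)} (hx : FirstHits (bar c) x)
    (y : List (X × Bool)) : FreeGroup.mk (c :: (x ++ y)) = FreeGroup.mk y := by
  rw [← List.cons_append, ← FreeGroup.mul_mk, (mk_cons_eq_one_iff c x).2 hx.1, one_mul]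

lemma exists_of_prefix_cons_append {b c : X × Bool} (hcb : c ≠ b) {x y p : List (X × Bool)}
    (hx : FirstHits (bar c) x) (hp : p <+: c :: (x ++ y)) (hb : FreeGroup.mk p = FreeGroup.mk [b]) :
    ∃ q, q <+: y ∧ p = c :: (x ++ q) ∧ FreeGroup.mk q = FreeGroup.mk [b] := by
  rcases List.prefix_cons_iff.1 hp with rfl | ⟨p', rfl, hp'⟩
  · exact absurd hb (mk_singleton_ne_one b)
  · rcases prefix_append_cases hp' with h | ⟨q, rfl, hq⟩
    · obtain ⟨p'', h1, h2⟩ := exists_prefix_eq_bar hcb hb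
      obtain rfl := hx.2 p'' (h1.trans h) h2
      obtain rfl := h.eq_of_length (le_antisymm h.length_le h1.length_le)
      rw [(mk_cons_eq_one_iff c p').2 h2] at hb
      exact absurd hb (mk_singleton_ne_one b)
    · exact ⟨q, hq, rfl, by rw [← hb, mk_cons_append_of_firstHits hx]⟩

lemma Avoids.cons {b c : X × Bool} (hcb : c ≠ b) {z : List (X × Bool)} (hz : Avoids (bar c) z) :
    Avoids b (c :: z) := by
  intro p hp hb
  rcases List.prefix_cons_iff.1 hp with rfl | ⟨p', rfl, hp'⟩
  · exact mk_singleton_ne_one b hb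
  · obtain ⟨q, hq, h⟩ := exists_prefix_eq_bar hcb hb
    exact hz q (hq.trans hp') h

/-- Nonterminals of the grammar of walks. -/
inductive WalkSym (A : Type*)
  /-- The empty walk. -/
  | empty : WalkSym A
  /-- Walks that visit the given neighbour of the identity at their end and not before. -/
  | first : A → WalkSym A
  /-- Walks that never visit the given neighbour of the identity. -/
  | avoid : A → WalkSym A
  /-- Walks that do not end at the identity. -/
  | nontrivial : WalkSym A
  /-- Nonempty walks that never return to the identity. -/
  | leave : WalkSym A

instance {A : Type*} [Finite A] : Finite (WalkSym A) :=
  Finite.of_surjective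
    (fun s : Option (Option (Option (A ⊕ A))) => match s with
      | none => WalkSym.empty
      | some none => WalkSym.nontrivial
      | some (some none) => WalkSym.leave
      | some (some (some (.inl a))) => WalkSym.first a
      | some (some (some (.inr a))) => WalkSym.avoid a)
    fun s => by
      cases s with
      | empty => exact ⟨none, rfl⟩
      | nontrivial => exact ⟨some none, rfl⟩
      | leave => exact ⟨some (some none), rfl⟩
      | first a => exact ⟨some (some (some (.inl a))), rfl⟩
      | avoid a => exact ⟨some (some (some (.inr a))), rfl⟩

/-- Nonterminals of the grammar of walks that produce the empty word. -/
inductive WalkNil : WalkSym (X × Bool) → Prop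
  | empty : WalkNil .empty
  | avoid (b : X × Bool) : WalkNil (.avoid b)

/-- Rules of the grammar of walks that start by reading a letter `c`. The walk after `c` either
returns to the identity, and is cut at its first return, or it does not. -/
inductive WalkCons : WalkSym (X × Bool) → X × Bool → WalkSym (X × Bool) → WalkSym (X × Bool) → Prop
  | hit (b : X × Bool) : WalkCons (.first b) b .empty .empty
  | first (b c : X × Bool) : c ≠ b → WalkCons (.first b) c (.first (bar c)) (.first b)
  | avoid_stay (b c : X × Bool) : c ≠ b → WalkCons (.avoid b) c (.avoid (bar c)) .empty
  | avoid_return (b c : X × Bool) : c ≠ b → WalkCons (.avoid b) c (.first (bar c)) (.avoid b)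
  | nontrivial_stay (c : X × Bool) : WalkCons .nontrivial c (.avoid (bar c)) .empty
  | nontrivial_return (c : X × Bool) : WalkCons .nontrivial c (.first (bar c)) .nontrivial
  | leave (c : X × Bool) : WalkCons .leave c (.avoid (bar c)) .empty

/-- The set of walks described by a nonterminal. -/
def WalkSym.Holds : WalkSym (X × Bool) → List (X × Bool) → Prop
  | .empty, z => z = []
  | .first b, z => FirstHits b z
  | .avoid b, z => Avoids b z
  | .nontrivial, z => FreeGroup.mk z ≠ 1
  | .leave, z => ∃ c y, z = c :: y ∧ Avoids (bar c) y

lemma holds_of_greibachGen {n : WalkSym (X × Bool)} {z : List (X × Bool)}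
    (h : GreibachGen WalkNil WalkCons n z) : n.Holds z := by
  induction h with
  | nil h =>
    cases h with
    | empty => rfl
    | avoid b =>
      intro p hp
      rw [List.prefix_nil.1 hp]
      exact mk_singleton_ne_one b
  | @cons n m m' a x y hB _ _ hx hy =>
    cases hB with
    | hit b =>
      obtain rfl : x = [] := hx
      obtain rfl : y = [] := hy
      refine ⟨rfl, fun p hp hb => ?_⟩
      rcases List.prefix_cons_iff.1 hp with rfl | ⟨p', rfl, hp'⟩
      · exact absurd hb (mk_singleton_ne_one _)
      · rw [List.prefix_nil.1 hp']
        rfl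
    | first b c hcb =>
      refine ⟨(mk_cons_append_of_firstHits hx y).trans hy.1, fun p hp hb => ?_⟩
      obtain ⟨q, hq, rfl, hqb⟩ := exists_of_prefix_cons_append hcb hx hp hb
      rw [hy.2 q hq hqb]
    | avoid_stay b c hcb =>
      obtain rfl : y = [] := hy
      rw [List.append_nil]
      exact Avoids.cons hcb hx
    | avoid_return b c hcb =>
      intro p hp hb
      obtain ⟨q, hq, rfl, hqb⟩ := exists_of_prefix_cons_append hcb hx hp hb
      exact hy q hq hqb
    | nontrivial_stay c =>
      obtain rfl : y = [] := hy
      rw [List.append_nil]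
      exact fun h => hx x List.prefix_rfl ((mk_cons_eq_one_iff _ x).1 h)
    | nontrivial_return c =>
      exact fun h => hy ((mk_cons_append_of_firstHits hx y).symm.trans h)
    | leave c =>
      obtain rfl : y = [] := hy
      exact ⟨a, x, by rw [List.append_nil], hx⟩

lemma greibachGen_of_holds (z : List (X × Bool)) :
    ∀ n : WalkSym (X × Bool), n.Holds z → GreibachGen WalkNil WalkCons n z := by
  induction hk : z.length using Nat.strong_induction_on generalizing z with
  | _ k ih =>
    have hnil : GreibachGen WalkNil WalkCons (.empty : WalkSym (X × Bool)) [] := .nil .empty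
    have hstay : ∀ c y n, z = c :: y → WalkCons n c (.avoid (bar c)) .empty → Avoids (bar c) y →
        GreibachGen WalkNil WalkCons n z := by
      rintro c y n rfl hn hy
      have h := GreibachGen.cons hn (ih _ (by simp [← hk]) y rfl _ hy) hnil
      rwa [List.append_nil] at h
    have hreturn : ∀ c x y n n', z = c :: (x ++ y) → WalkCons n c (.first (bar c)) n' →
        FirstHits (bar c) x → n'.Holds y → GreibachGen WalkNil WalkCons n z := by
      rintro c x y n n' rfl hn hx hy
      exact .cons hn (ih _ (by simp [← hk]) x rfl (.first _) hx)
        (ih _ (by simp [← hk]) y rfl _ hy)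
    intro n hz
    cases n with
    | empty =>
      obtain rfl : z = [] := hz
      exact hnil
    | first b =>
      cases z with
      | nil => exact absurd hz.1 (mk_singleton_ne_one b)
      | cons c y =>
        by_cases hcb : c = b
        · subst hcb
          have h := hz.2 [c] (by simp) rfl
          obtain rfl : [] = y := (List.cons_eq_cons.1 h).2
          exact .cons (.hit c) hnil hnil
        · obtain ⟨p, hp, hpc⟩ := exists_prefix_eq_bar hcb hz.1
          obtain ⟨x, y, rfl, hx⟩ := exists_firstHits (b := bar c) (z := y) fun h => h p hp hpc
          refine hreturn c x y _ _ rfl (.first b c hcb) hx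
            ⟨(mk_cons_append_of_firstHits hx y).symm.trans hz.1, fun q hq hqb => ?_⟩
          have h := hz.2 (c :: (x ++ q)) (by simpa using hq)
            ((mk_cons_append_of_firstHits hx q).trans hqb)
          simpa using h
    | avoid b =>
      cases z with
      | nil => exact .nil (.avoid b)
      | cons c y =>
        have hcb : c ≠ b := by
          rintro rfl
          exact hz [c] (by simp) rfl
        by_cases hy : Avoids (bar c) y
        · exact hstay c y _ rfl (.avoid_stay b c hcb) hy
        · obtain ⟨x, y, rfl, hx⟩ := exists_firstHits hy
          refine hreturn c x y _ _ rfl (.avoid_return b c hcb) hx fun q hq hqb => ?_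
          exact hz (c :: (x ++ q)) (by simpa using hq)
            ((mk_cons_append_of_firstHits hx q).trans hqb)
    | nontrivial =>
      cases z with
      | nil => exact absurd FreeGroup.one_eq_mk.symm hz
      | cons c y =>
        by_cases hy : Avoids (bar c) y
        · exact hstay c y _ rfl (.nontrivial_stay c) hy
        · obtain ⟨x, y, rfl, hx⟩ := exists_firstHits hy
          exact hreturn c x y _ _ rfl (.nontrivial_return c) hx fun h =>
            hz ((mk_cons_append_of_firstHits hx y).trans h)
    | leave =>
      obtain ⟨c, y, rfl, hy⟩ := hz
      exact hstay c y _ rfl (.leave c) hy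

end FIM

/-! ### Unequal pairs of words as context-free languages -/

namespace FIM

variable {X : Type*}

/-- Some vertex on the path `u` is followed by a letter `a` after which the rest of `u`, continued
by `w`, never returns to that vertex. -/
def Unmatched (u w : List (X × Bool)) : Prop :=
  ∃ p a s, u = p ++ a :: s ∧ Avoids (bar a) (s ++ w)

/-- For a path `u ++ w` that ends where it starts, the right-hand side says that some vertex of `u`
is not visited by `w`: the vertex before the suffix `s` of `u` is visited by `w` exactly when some
prefix of `w` completes `s` to a closed path. -/
lemma unmatched_iff (u w : List (X × Bool)) :
    Unmatched u w ↔ ∃ s, s <:+ u ∧ ∀ w1, w1 <+: w → FreeGroup.mk (s ++ w1) ≠ 1 := by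
  constructor
  · rintro ⟨p, a, s, rfl, h⟩
    refine ⟨a :: s, List.suffix_append _ _, fun w1 hw1 h1 => ?_⟩
    exact h (s ++ w1) (by simpa using hw1) ((mk_cons_eq_one_iff a _).1 h1)
  · rintro ⟨s, hs, h⟩
    -- The last visit of the walk `s` to its starting point is the place to cut.
    induction hn : s.length using Nat.strong_induction_on generalizing s with
    | _ n ih =>
      cases s with
      | nil => exact absurd FreeGroup.one_eq_mk.symm (h [] List.nil_prefix)
      | cons a s =>
        obtain ⟨p, rfl⟩ := hs
        by_cases hs : Avoids (bar a) s
        · refine ⟨p, a, s, rfl, fun z hz hza => ?_⟩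
          rcases prefix_append_cases hz with h1 | ⟨q, rfl, hq⟩
          · exact hs z h1 hza
          · exact h q hq ((mk_cons_eq_one_iff a _).2 hza)
        · obtain ⟨x, y, rfl, hx⟩ := exists_firstHits hs
          refine ih y.length (by simp [← hn]) y ⟨p ++ a :: x, by simp⟩
            (fun w1 hw1 h1 => h w1 hw1 ?_) rfl
          rw [List.cons_append, List.append_assoc, mk_cons_append_of_firstHits hx, h1]

lemma mk_invRev_eq_one_iff (w : List (X × Bool)) :
    FreeGroup.mk (FreeGroup.invRev w) = 1 ↔ FreeGroup.mk w = 1 := by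
  rw [← FreeGroup.inv_mk, inv_eq_one]

lemma not_unmatched_iff {u w : List (X × Bool)} (h : FreeGroup.mk (u ++ w) = 1) :
    ¬Unmatched u w ↔ munnTree u ⊆ munnTree (FreeGroup.invRev w) := by
  rw [unmatched_iff]
  push Not
  have huw : (FreeGroup.mk u)⁻¹ = FreeGroup.mk w := by
    rwa [← FreeGroup.mul_mk, mul_eq_one_iff_inv_eq] at h
  constructor
  · rintro H _ ⟨p, ⟨s, rfl⟩, rfl⟩
    obtain ⟨w1, ⟨w2, rfl⟩, h1⟩ := H s (List.suffix_append _ _)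
    refine ⟨FreeGroup.invRev w2, ?_, ?_⟩
    · rw [FreeGroup.invRev_append]
      exact List.prefix_append _ _
    · rw [← FreeGroup.inv_mk, inv_eq_iff_mul_eq_one]
      simp only [← FreeGroup.mul_mk] at h h1
      have h2 : FreeGroup.mk w1 = (FreeGroup.mk s)⁻¹ := (mul_eq_one_iff_inv_eq.1 h1).symm
      rw [h2, mul_assoc, mul_inv_cancel_left, mul_eq_one_iff_eq_inv] at h
      rw [h, mul_inv_cancel]
  · rintro H s ⟨p, rfl⟩
    obtain ⟨q, ⟨r, hr⟩, hq⟩ := H ⟨p, List.prefix_append _ _, rfl⟩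
    have hw : w = FreeGroup.invRev r ++ FreeGroup.invRev q := by
      rw [← FreeGroup.invRev_append, hr, FreeGroup.invRev_invRev]
    refine ⟨FreeGroup.invRev r, hw ▸ List.prefix_append _ _, ?_⟩
    rw [hw] at h
    simp only [← FreeGroup.mul_mk, ← FreeGroup.inv_mk] at h ⊢
    rw [hq, ← mul_assoc, mul_inv_eq_one, mul_assoc] at h
    exact mul_eq_left.1 h

/-- Inequality in the free inverse monoid, through Munn's theorem. -/
lemma eval_ne_iff (u w : List (X × Bool)) :
    eval u ≠ eval (FreeGroup.invRev w) ↔ FreeGroup.mk (u ++ w) ≠ 1 ∨ Unmatched u w ∨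
      Unmatched (FreeGroup.invRev w) (FreeGroup.invRev u) := by
  rw [← not_iff_not]
  push Not
  rw [eval_eq_eval_iff, ← FreeGroup.inv_mk, ← mul_eq_one_iff_eq_inv, FreeGroup.mul_mk]
  refine and_congr_right fun h => ?_
  have h' : FreeGroup.mk (FreeGroup.invRev w ++ FreeGroup.invRev u) = 1 := by
    rwa [← FreeGroup.invRev_append, mk_invRev_eq_one_iff]
  rw [not_unmatched_iff h, not_unmatched_iff h', FreeGroup.invRev_invRev]
  exact Set.Subset.antisymm_iff

/-- States of the transducer that erases `#` from `u # w`, after deleting a prefix of `u`. -/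
inductive Phase
  /-- The letters read so far are deleted. -/
  | skipping
  /-- The symbol `#` has not been read, and letters are copied. -/
  | before
  /-- The symbol `#` has been read, and letters are copied. -/
  | after

instance : Finite Phase :=
  Finite.of_surjective (fun i : Fin 3 => ![Phase.skipping, Phase.before, Phase.after] i) fun s => by
    cases s with
    | skipping => exact ⟨0, rfl⟩
    | before => exact ⟨1, rfl⟩
    | after => exact ⟨2, rfl⟩

/-- Steps of the transducer that erases `#`. The letters it reads are encoded by `σ` before the
symbol `#` and by `τ` after it. -/
inductive PhaseStep {A : Type*} (σ τ : A → A) : Phase → Option A → Option A → Phase → Prop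
  | skip (a : A) : PhaseStep σ τ .skipping (some (σ a)) none .skipping
  | start (a : A) : PhaseStep σ τ .skipping (some (σ a)) (some a) .before
  | before (a : A) : PhaseStep σ τ .before (some (σ a)) (some a) .before
  | hash : PhaseStep σ τ .before none none .after
  | after (a : A) : PhaseStep σ τ .after (some (τ a)) (some a) .after

section Transducer

variable {A : Type*} {σ τ : A → A}

/-- The pairs of input and output of the transducer, by initial state. -/
def PhaseRel (σ τ : A → A) : Phase → List (Option A) → List A → Prop
  | .skipping, z, y => ∃ p a s w, y = a :: (s ++ w) ∧
      z = hashWord ((p ++ a :: s).map σ) (w.map τ)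
  | .before, z, y => ∃ s w, y = s ++ w ∧ z = hashWord (s.map σ) (w.map τ)
  | .after, z, y => z = (y.map τ).map some

lemma phaseRel_of_run {s t : Phase} {z : List (Option A)} {y : List A}
    (h : TransducerRun (PhaseStep σ τ) s z t y) (ht : t = .after) : PhaseRel σ τ s z y := by
  induction h with
  | nil s =>
    subst ht
    rfl
  | skip hs _ ih =>
    have ih := ih ht
    cases hs with
    | skip b =>
      obtain ⟨p, a, s, w, rfl, rfl⟩ := ih
      exact ⟨b :: p, a, s, w, rfl, rfl⟩
    | hash =>
      obtain rfl := ih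
      exact ⟨[], _, rfl, rfl⟩
  | emit hs _ ih =>
    have ih := ih ht
    cases hs with
    | start =>
      obtain ⟨s, w, rfl, rfl⟩ := ih
      exact ⟨[], _, s, w, rfl, rfl⟩
    | before =>
      obtain ⟨s, w, rfl, rfl⟩ := ih
      exact ⟨_ :: s, w, rfl, rfl⟩
    | after =>
      obtain rfl := ih
      rfl

lemma run_after (w : List A) :
    TransducerRun (PhaseStep σ τ) .after ((w.map τ).map some) .after w := by
  induction w with
  | nil => exact .nil _
  | cons a w ih => exact .emit (.after a) ih

lemma run_before (s w : List A) :
    TransducerRun (PhaseStep σ τ) .before (hashWord (s.map σ) (w.map τ)) .after (s ++ w) := by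
  induction s with
  | nil => exact .skip .hash (run_after w)
  | cons a s ih => exact .emit (.before a) ih

lemma run_skipping (p : List A) (a : A) (s w : List A) :
    TransducerRun (PhaseStep σ τ) .skipping (hashWord ((p ++ a :: s).map σ) (w.map τ)) .after
      (a :: (s ++ w)) := by
  induction p with
  | nil => exact .emit (.start a) (run_before s w)
  | cons b p ih => exact .skip (.skip b) ih

end Transducer

lemma reverse_hashWord {A : Type*} (u v : List A) :
    (hashWord u v).reverse = hashWord v.reverse u.reverse := by
  simp [hashWord]

lemma map_invRev {A : Type*} (f : X × Bool → A) (w : List (X × Bool)) :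
    (FreeGroup.invRev w).map (fun a => f (bar a)) = (w.map f).reverse := by
  simp [invRev_eq, List.map_reverse, Function.comp_def]

variable [Finite X]

lemma isContextFree_unmatched (σ τ : X × Bool → X × Bool) :
    Language.IsContextFree ({z | ∃ u w, Unmatched u w ∧ z = hashWord (u.map σ) (w.map τ)} :
      Language (Option (X × Bool))) := by
  refine Language.IsContextFree.congr (isContextFree_transducerRun WalkNil WalkCons (PhaseStep σ τ)
      (.leave : WalkSym (X × Bool)) .skipping .after) fun z => ?_
  constructor
  · rintro ⟨_, w, ⟨p, a, s, rfl, h⟩, rfl⟩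
    exact ⟨_, greibachGen_of_holds _ _ ⟨a, s ++ w, rfl, h⟩, run_skipping p a s w⟩
  · rintro ⟨y, hy, hz⟩
    obtain ⟨p, a, s, w, rfl, rfl⟩ := phaseRel_of_run hz rfl
    obtain ⟨b, x, hbx, hx⟩ := holds_of_greibachGen hy
    obtain ⟨rfl, rfl⟩ := List.cons_eq_cons.1 hbx
    exact ⟨_, w, ⟨p, a, s, rfl, hx⟩, rfl⟩

lemma isContextFree_mk_ne_one (σ τ : X × Bool → X × Bool) :
    Language.IsContextFree ({z | ∃ u w, FreeGroup.mk (u ++ w) ≠ 1 ∧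
      z = hashWord (u.map σ) (w.map τ)} : Language (Option (X × Bool))) := by
  refine Language.IsContextFree.congr (isContextFree_transducerRun WalkNil WalkCons (PhaseStep σ τ)
      (.nontrivial : WalkSym (X × Bool)) .before .after) fun z => ?_
  constructor
  · rintro ⟨u, w, h, rfl⟩
    exact ⟨_, greibachGen_of_holds (u ++ w) .nontrivial h, run_before u w⟩
  · rintro ⟨y, hy, hz⟩
    obtain ⟨u, w, rfl, rfl⟩ := phaseRel_of_run hz rfl
    exact ⟨u, w, holds_of_greibachGen hy, rfl⟩

/-- The language of the words `u # τ(w)` such that `u` and `w⁻¹` differ in the free inverse monoid.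
The letter map `τ` covers both forms of the word problem. -/
lemma isContextFree_eval_ne (τ : X × Bool → X × Bool) :
    Language.IsContextFree ({z | ∃ u w, eval u ≠ eval (FreeGroup.invRev w) ∧
      z = hashWord u (w.map τ)} : Language (Option (X × Bool))) := by
  refine Language.IsContextFree.congr (((isContextFree_mk_ne_one id τ).sup
    (isContextFree_unmatched id τ)).sup
    (isContextFree_unmatched (fun a => τ (bar a)) bar).reverse) fun z => ?_
  simp only [eval_ne_iff]
  constructor
  · rintro ⟨u, w, h | h | h, rfl⟩
    · exact .inl (.inl ⟨u, w, h, by rw [List.map_id]⟩)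
    · exact .inl (.inr ⟨u, w, h, by rw [List.map_id]⟩)
    · -- Reversing `u # τ(w)` gives the same kind of word for the pair `(w⁻¹, u⁻¹)`, with other
      -- letter maps.
      refine .inr ⟨_, _, h, ?_⟩
      rw [reverse_hashWord, map_invRev τ w, ← List.map_id u, ← map_invRev id u, List.map_id]
      rfl
  · rintro ((⟨u, w, h, rfl⟩ | ⟨u, w, h, rfl⟩) | ⟨u, w, h, hz⟩)
    · exact ⟨u, w, .inl h, by rw [List.map_id]⟩
    · exact ⟨u, w, .inr (.inl h), by rw [List.map_id]⟩
    · refine ⟨FreeGroup.invRev w, FreeGroup.invRev u, .inr (.inr ?_), ?_⟩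
      · rwa [FreeGroup.invRev_invRev, FreeGroup.invRev_invRev]
      · rw [← List.reverse_reverse z, hz, reverse_hashWord]
        simp [invRev_eq, Function.comp_def]

end FIM

/-! ### Words that do not have the form `u # v` -/

/-- Steps of the transducer that counts, up to two, the occurrences of `#` and writes nothing. -/
def HashCountStep {A : Type*} (s : Fin 3) (x : Option A) (o : Option Empty) (t : Fin 3) : Prop :=
  o = none ∧ t.val = min (s.val + if x.isNone then 1 else 0) 2

lemma hashCount_run_iff {A : Type*} (z : List (Option A)) (s t : Fin 3) :
    TransducerRun HashCountStep s z t [] ↔ t.val = min (s.val + z.countP Option.isNone) 2 := by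
  induction z generalizing s with
  | nil =>
    constructor
    · rintro ⟨⟩
      simp
      omega
    · intro h
      obtain rfl : t = s := Fin.ext (by simp at h; omega)
      exact .nil t
  | cons x z ih =>
    rw [List.countP_cons]
    constructor
    · intro h
      cases h with
      | skip hs hr =>
        have h1 := (ih _).1 hr
        have h2 := hs.2
        omega
    · intro h
      refine .skip (r := ⟨min (s.val + if x.isNone then 1 else 0) 2, by omega⟩) ⟨rfl, rfl⟩
        ((ih _).2 ?_)
      simp only
      omega

lemma exists_hashWord_iff {A : Type*} (z : List (Option A)) :
    (∃ u v, z = hashWord u v) ↔ z.countP Option.isNone = 1 := by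
  have hmap : ∀ z : List (Option A), z.countP Option.isNone = 0 → ∃ v : List A, z = v.map some := by
    intro z hz
    induction z with
    | nil => exact ⟨[], rfl⟩
    | cons x z ih =>
      cases x with
      | none => simp at hz
      | some a =>
        obtain ⟨v, rfl⟩ := ih (by simpa using hz)
        exact ⟨a :: v, rfl⟩
  have hmap' : ∀ v : List A, (v.map some).countP Option.isNone = 0 := by
    intro v
    simp
  constructor
  · rintro ⟨u, v, rfl⟩
    rw [hashWord, List.countP_append, List.countP_cons, hmap', hmap']
    rfl
  · intro hz
    induction z with
    | nil => simp at hz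
    | cons x z ih =>
      cases x with
      | none =>
        obtain ⟨v, rfl⟩ := hmap z (by simpa using hz)
        exact ⟨[], v, rfl⟩
      | some a =>
        obtain ⟨u, v, rfl⟩ := ih (by simpa using hz)
        exact ⟨a :: u, v, rfl⟩

lemma isContextFree_not_hashWord (A : Type*) [Finite A] :
    Language.IsContextFree ({z | ¬∃ u v, z = hashWord u v} : Language (Option A)) := by
  have key : ∀ t : Fin 3, Language.IsContextFree
      ({z | t.val = min (z.countP Option.isNone) 2} : Language (Option A)) := by
    intro t
    refine Language.IsContextFree.congr (isContextFree_transducerRun (N := Unit) (fun _ => True)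
      (fun _ _ _ _ => False)
      (HashCountStep (A := A)) () 0 t) fun z => ?_
    have h := hashCount_run_iff z 0 t
    rw [Fin.val_zero, zero_add] at h
    refine Iff.trans h.symm ⟨fun h => ⟨[], .nil trivial, h⟩, ?_⟩
    rintro ⟨y, hy, hz⟩
    cases y with
    | nil => exact hz
    | cons e => exact e.elim
  refine Language.IsContextFree.congr ((key 0).sup (key 2)) fun z => ?_
  refine Iff.trans (not_congr (exists_hashWord_iff z)) ?_
  change _ ↔ (0 = min (z.countP Option.isNone) 2 ∨ 2 = min (z.countP Option.isNone) 2)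
  omega

lemma hashWord_inj {A : Type*} {u v u' v' : List A} (h : hashWord u v = hashWord u' v') :
    u = u' ∧ v = v' := by
  induction u generalizing u' with
  | nil =>
    cases u' with
    | nil =>
      exact ⟨rfl, List.map_injective_iff.2 (Option.some_injective A) (List.cons_eq_cons.1 h).2⟩
    | cons b u' => cases (List.cons_eq_cons.1 h).1
  | cons a u ih =>
    cases u' with
    | nil => cases (List.cons_eq_cons.1 h).1
    | cons b u' =>
      obtain ⟨h1, h2⟩ := List.cons_eq_cons.1 h
      obtain ⟨rfl, rfl⟩ := ih h2
      exact ⟨by rw [Option.some_injective A h1], rfl⟩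

/-- If every word `v` is written as `f v` after `#`, with `f` bijective, then the complement of the
language of related pairs consists of the unrelated pairs and the words not of the form `u # v`. -/
lemma isCoContextFree_of_isContextFree_not {A : Type*} [Finite A] (r : List A → List A → Prop)
    (f : List A → List A) (hf : Function.Bijective f)
    (h : Language.IsContextFree
      ({s | ∃ u v, ¬r u v ∧ s = hashWord u (f v)} : Language (Option A))) :
    IsCoContextFree ({s | ∃ u v, r u v ∧ s = hashWord u (f v)} : Language (Option A)) := by
  unfold IsCoContextFree
  refine Language.IsContextFree.congr ((isContextFree_not_hashWord A).sup h) fun z => ?_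
  change (¬∃ u v, r u v ∧ z = hashWord u (f v)) ↔
    (¬∃ u v, z = hashWord u v) ∨ ∃ u v, ¬r u v ∧ z = hashWord u (f v)
  constructor
  · intro hz
    by_cases hw : ∃ u v, z = hashWord u v
    · obtain ⟨u, v, rfl⟩ := hw
      obtain ⟨v, rfl⟩ := hf.2 v
      exact .inr ⟨u, v, fun hr => hz ⟨u, v, hr, rfl⟩, rfl⟩
    · exact .inl hw
  · rintro (hz | ⟨u, v, hr, rfl⟩) ⟨u', v', hr', h'⟩
    · exact hz ⟨u', _, h'⟩
    · obtain ⟨rfl, h2⟩ := hashWord_inj h'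
      rw [hf.1 h2] at hr
      exact hr hr'

/-! ### The word problem of the free inverse monoid -/

theorem mainTheorem1 (X : Type*) [Finite X] :
    IsCoContextFree (wordProblem (FIM.of (X := X))) ∧
    IsCoContextFree (invWordProblem (FIM.of (X := X))) ∧
    Language.IsContextFree (coWordProblem (FIM.of (X := X))) := by
  have hco : Language.IsContextFree (coWordProblem (FIM.of (X := X))) := by
    refine Language.IsContextFree.congr (FIM.isContextFree_eval_ne (X := X) id) fun z => ?_
    simp only [coWordProblem, FIM.prod_map_of, List.map_id]
    constructor
    · rintro ⟨u, v, h, rfl⟩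
      exact ⟨u, FreeGroup.invRev v, by rwa [FreeGroup.invRev_invRev], rfl⟩
    · rintro ⟨u, w, h, rfl⟩
      exact ⟨u, FreeGroup.invRev w, h, by rw [FreeGroup.invRev_invRev]⟩
  refine ⟨?_, ?_, hco⟩
  · refine isCoContextFree_of_isContextFree_not _ List.reverse List.reverse_involutive.bijective ?_
    refine Language.IsContextFree.congr (FIM.isContextFree_eval_ne (X := X) FIM.bar) fun z => ?_
    simp only [FIM.prod_map_of]
    -- Inverting each letter of `v⁻¹` gives `v` reversed.
    have hbar : ∀ v : List (X × Bool), (FreeGroup.invRev v).map FIM.bar = v.reverse := fun v => by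
      simp [FIM.invRev_eq, List.map_reverse, Function.comp_def]
    constructor
    · rintro ⟨u, v, h, rfl⟩
      exact ⟨u, FreeGroup.invRev v, by rwa [FreeGroup.invRev_invRev], by rw [hbar]⟩
    · rintro ⟨u, w, h, rfl⟩
      exact ⟨u, FreeGroup.invRev w, h, by rw [← hbar, FreeGroup.invRev_invRev]⟩
  · exact isCoContextFree_of_isContextFree_not _ _ FreeGroup.invRev_bijective hco
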